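/- Let $\mathbb{F}_2$ be the field with two elements and let $e_1,\dots,e_n$ be the standard basis of $\mathbb{F}_2^n$. A set $A\subseteq\mathbb{F}_2^n$ is called a downset if, whenever $1\le i\le n$, $x\in\mathbb{F}_2^n$ has $i$-th coordinate $x_i=0$, and $x+e_i\in A$, we also have $x\in A$. For a non-empty set $A\subseteq\mathbb{F}_2^n$ write $A+A=\{a+b: a,b\in A\}$ and let $\sigma[A]:=|A+A|/|A|$ be its doubling constant. For $J\subseteq\{1,\dots,n\}$ the coordinate subspace $\mathbb{F}_2^J\subseteq\mathbb{F}_2^n$ is the set of all $x$ with $x_i=0$ for every $i\notin J$. Theorem. There is an absolute constant $C>0$ such that for every $n\ge 0$ and every non-empty downset $A\subseteq\mathbb{F}_2^n$ there is a set $J\subseteq\{1,\dots,n\}$ with $|\mathbb{F}_2^J|\le|A|$ such that $A$ is contained in a union of at most $C\,\sigma[A]^{46}$ translates of $\mathbb{F}_2^J$. -/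

import Mathlib

open scoped Pointwise Combinatorics.Additive

/-- A set `A ⊆ 𝔽₂ⁿ` is a downset if it is closed under replacing a coordinate `1` by `0`. -/
def IsDownset {n : ℕ} (A : Finset (Fin n → ZMod 2)) : Prop :=
  ∀ (i : Fin n) (x : Fin n → ZMod 2), x i = 0 → x + Pi.single i 1 ∈ A → x ∈ A

/-- The coordinate subspace `𝔽₂ᴶ` of `𝔽₂ⁿ`: the vectors supported on `J`. -/
def coordSubspace {n : ℕ} (J : Finset (Fin n)) : Submodule (ZMod 2) (Fin n → ZMod 2) where
  carrier := {x | ∀ i, i ∉ J → x i = 0}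
  zero_mem' := fun _ _ => rfl
  add_mem' := fun {x y} hx hy i hi => by
    change x i + y i = 0
    rw [hx i hi, hy i hi, add_zero]
  smul_mem' := fun c x hx i hi => by
    change c * x i = 0
    rw [hx i hi, mul_zero]

/-! Let `v` be uniform on `A` and `K` the doubling constant. Since `selfConv v` lives on `A + A`,
its entropy exceeds that of `v` by at most log K. Averaging over one coordinate direction commutes
with self-convolution (`selfConv_dirAvg`), and averaging over all of them gives the uniform law,
whose self-convolution is itself. So the growth is the sum, over the coordinates, of the gain of `v`
minus the gain of `selfConv v` at each step.

A step contributes at least 1/45 of the gain κ of `v` if the coordinate is often nonzero, and 1/45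
of log 2 - κ if it is rarely nonzero. The downset property keeps this dichotomy stable under earlier
averaging (`coordMass_coordAvg`). Let J be the frequent coordinates and E the entropy of `v`
averaged over J. Averaging J first gives (E - log |A|) + (E - |J| log 2) ≤ 45 log K.

Both brackets are nonnegative. Bounding the second gives a large J-part of `A`, hence few elements
of `A` supported off J. The first controls the cost of shrinking J until its subspace has at most
|A| elements. -/

open Real in
/-- The unnormalised deficit `(a + b) * (log 2 - binEntropy (a / (a + b)))` of a pair of masses. -/
noncomputable def entropyDeficit (a b : ℝ) : ℝ :=
  2 * negMulLog ((a + b) / 2) - negMulLog a - negMulLog b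

/-! ### Convexity of the two-point entropy deficit. -/

namespace entropyDeficit

open Real

theorem comm (a b : ℝ) : entropyDeficit a b = entropyDeficit b a := by
  unfold entropyDeficit
  rw [add_comm a b]
  ring

@[simp] theorem self (a : ℝ) : entropyDeficit a a = 0 := by
  unfold entropyDeficit
  rw [add_self_div_two]
  ring

theorem mul (c a b : ℝ) : entropyDeficit (c * a) (c * b) = c * entropyDeficit a b := by
  unfold entropyDeficit
  rw [← mul_add, mul_div_assoc, negMulLog_mul, negMulLog_mul, negMulLog_mul]
  ring

/-- The tangent bound log t ≤ t - 1 at t = y r / x; the source of every Gibbs-type inequality below.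
-/
theorem mul_log_le {x y r : ℝ} (hx : 0 ≤ x) (hy : 0 < y) (hr : 0 ≤ r) (h : r = 0 → x = 0) :
    x * log r + x - y * r ≤ x * log x - x * log y := by
  rcases hx.eq_or_lt with rfl | hx
  · simp only [zero_mul, zero_add, zero_sub, sub_self]
    have := mul_nonneg hy.le hr
    linarith
  have hr : 0 < r := lt_of_le_of_ne hr fun h0 => hx.ne' (h h0.symm)
  have h1 := log_le_sub_one_of_pos (x := y * r / x) (by positivity)
  rw [log_div (by positivity) hx.ne', log_mul hy.ne' hr.ne'] at h1
  have h2 := mul_le_mul_of_nonneg_left h1 hx.le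
  have h3 : x * (y * r / x - 1) = y * r - x := by field_simp
  linarith

/-- Half of a variational formula: the deficit dominates functionals linear in (a, b). By
`eq_of_pos` it is attained at r = 2a/(a+b), s = 2b/(a+b). -/
theorem le_of_ratios {a b r s : ℝ} (ha : 0 ≤ a) (hb : 0 ≤ b) (hr : 0 ≤ r) (hs : 0 ≤ s)
    (hrs : r + s = 2) (hra : r = 0 → a = 0) (hsb : s = 0 → b = 0) :
    a * log r + b * log s ≤ entropyDeficit a b := by
  rcases (add_nonneg ha hb).eq_or_lt with h | h
  · have ha' : a = 0 := by linarith
    have hb' : b = 0 := by linarith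
    subst ha' hb'
    simp
  have hM : 0 < (a + b) / 2 := by linarith
  have h1 := mul_log_le ha hM hr hra
  have h2 := mul_log_le hb hM hs hsb
  unfold entropyDeficit negMulLog
  have h3 : (a + b) / 2 * r + (a + b) / 2 * s = a + b := by rw [← mul_add, hrs]; ring
  nlinarith

theorem eq_of_pos {a b : ℝ} (ha : 0 ≤ a) (hb : 0 ≤ b) (h : 0 < a + b) :
    entropyDeficit a b = a * log (2 * a / (a + b)) + b * log (2 * b / (a + b)) := by
  have key : ∀ x : ℝ, 0 ≤ x → x * log (2 * x / (a + b)) = x * log x - x * log ((a + b) / 2) := by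
    intro x hx
    rcases hx.eq_or_lt with rfl | hx
    · simp
    have : 2 * x / (a + b) = x / ((a + b) / 2) := by field_simp
    rw [this, log_div hx.ne' (by positivity)]
    ring
  rw [key a ha, key b hb]
  unfold entropyDeficit negMulLog
  ring

/-- A maximum of linear functionals is subadditive: the optimal ratios for the sum are tested on
each summand. -/
theorem add_le {a b c d : ℝ} (ha : 0 ≤ a) (hb : 0 ≤ b) (hc : 0 ≤ c) (hd : 0 ≤ d) :
    entropyDeficit (a + c) (b + d) ≤ entropyDeficit a b + entropyDeficit c d := by
  rcases (add_nonneg (add_nonneg ha hc) (add_nonneg hb hd)).eq_or_lt with h | h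
  · have ha' : a = 0 := by linarith
    have hb' : b = 0 := by linarith
    have hc' : c = 0 := by linarith
    have hd' : d = 0 := by linarith
    subst ha' hb' hc' hd'
    simp
  rw [eq_of_pos (by positivity) (by positivity) h]
  set r := 2 * (a + c) / (a + c + (b + d)) with hr
  set s := 2 * (b + d) / (a + c + (b + d)) with hs
  have hr0 : 0 ≤ r := by positivity
  have hs0 : 0 ≤ s := by positivity
  have hrs : r + s = 2 := by rw [hr, hs]; field_simp
  have hra : r = 0 → a + c = 0 := fun h0 => by
    rcases div_eq_zero_iff.1 (hr ▸ h0) with h1 | h1 <;> linarith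
  have hsb : s = 0 → b + d = 0 := fun h0 => by
    rcases div_eq_zero_iff.1 (hs ▸ h0) with h1 | h1 <;> linarith
  have h1 := le_of_ratios ha hb hr0 hs0 hrs (fun h => by have := hra h; linarith)
    (fun h => by have := hsb h; linarith)
  have h2 := le_of_ratios hc hd hr0 hs0 hrs (fun h => by have := hra h; linarith)
    (fun h => by have := hsb h; linarith)
  linarith

theorem nonneg {a b : ℝ} (ha : 0 ≤ a) (hb : 0 ≤ b) : 0 ≤ entropyDeficit a b := by
  simpa using le_of_ratios ha hb zero_le_one zero_le_one (by norm_num) (by simp) (by simp)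

theorem sum_le {ι : Type*} (s : Finset ι) {f g : ι → ℝ} (hf : ∀ i, 0 ≤ f i) (hg : ∀ i, 0 ≤ g i) :
    entropyDeficit (∑ i ∈ s, f i) (∑ i ∈ s, g i) ≤ ∑ i ∈ s, entropyDeficit (f i) (g i) := by
  classical
  induction s using Finset.induction_on with
  | empty => simp
  | insert i s hi ih =>
    rw [Finset.sum_insert hi, Finset.sum_insert hi, Finset.sum_insert hi]
    exact (add_le (hf i) (hg i) (Finset.sum_nonneg fun _ _ => hf _)
      (Finset.sum_nonneg fun _ _ => hg _)).trans (by linarith)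

/-- The pair splits as (c - d)(a, b) + d(a + b, a + b), and the constant pair has deficit zero. -/
theorem cross_le_mul {a b c d : ℝ} (ha : 0 ≤ a) (hb : 0 ≤ b) (hd : 0 ≤ d) (hdc : d ≤ c) :
    entropyDeficit (a * c + b * d) (a * d + b * c) ≤ (c - d) * entropyDeficit a b := by
  have h := add_le (a := (c - d) * a) (b := (c - d) * b) (c := d * (a + b)) (d := d * (a + b))
    (mul_nonneg (by linarith) ha) (mul_nonneg (by linarith) hb) (by positivity) (by positivity)
  rw [self, add_zero, mul] at h
  convert h using 2 <;> ring

theorem negMulLog_add_ge {u v : ℝ} (hu : 0 ≤ u) (hv : 0 ≤ v) :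
    negMulLog u + negMulLog v - (u + v) * log 2 ≤ negMulLog (u + v) := by
  have h := nonneg hu hv
  unfold entropyDeficit at h
  rw [div_eq_mul_inv, negMulLog_mul] at h
  have : negMulLog (2⁻¹ : ℝ) = 2⁻¹ * log 2 := by simp [negMulLog]
  rw [this] at h
  linarith

theorem negMulLog_one_sub_le {p : ℝ} (hp : p ≤ 1) : negMulLog (1 - p) ≤ p := by
  have h := mul_log_le (x := 1 - p) (y := 1) (r := 1) (by linarith) one_pos zero_le_one (by simp)
  simp at h
  unfold negMulLog
  linarith

theorem one_sub_right {p : ℝ} :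
    entropyDeficit (1 - p) p = log 2 - negMulLog (1 - p) - negMulLog p := by
  unfold entropyDeficit
  have : negMulLog ((1 - p + p) / 2 : ℝ) = 2⁻¹ * log 2 := by simp [negMulLog]
  rw [this]
  ring

/-- For independent bits of parameters p and q with p, q small, the entropy of the sum is nearly
h(p) + h(q), since the sum is 1 through two almost separate events. Merging these events costs at
most (p + q) log 2 ≤ 0.7 (p + q), and dropping `negMulLog (1 - p)` and `negMulLog (1 - q)` costs at
most p + q, whence 17/10. -/
theorem cross_le_of_one {p q : ℝ} (hp : 0 ≤ p) (hq : 0 ≤ q) (hp1 : p ≤ 1) (hq1 : q ≤ 1) :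
    entropyDeficit ((1 - p) * (1 - q) + p * q) ((1 - p) * q + p * (1 - q)) ≤
      log 2 - (1 - q) * (log 2 - entropyDeficit (1 - p) p)
        - (1 - p) * (log 2 - entropyDeficit (1 - q) q) + 17 / 10 * (p + q) := by
  have e : (1 - p) * (1 - q) + p * q = 1 - ((1 - p) * q + p * (1 - q)) := by ring
  have h1 : 0 ≤ (1 - p) * q := mul_nonneg (by linarith) hq
  have h2 : 0 ≤ p * (1 - q) := mul_nonneg hp (by linarith)
  have h3 : 0 ≤ (1 - p) * (1 - q) := mul_nonneg (by linarith) (by linarith)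
  have h4 : 0 ≤ p * q := mul_nonneg hp hq
  rw [e, one_sub_right, one_sub_right, one_sub_right]
  have h5 := negMulLog_add_ge h1 h2
  have h6 : 0 ≤ negMulLog (1 - ((1 - p) * q + p * (1 - q))) :=
    negMulLog_nonneg (by linarith) (by linarith)
  rw [negMulLog_mul, negMulLog_mul] at h5
  have h7 : 0 ≤ q * negMulLog (1 - p) :=
    mul_nonneg hq (negMulLog_nonneg (by linarith) (by linarith))
  have h8 : 0 ≤ p * negMulLog (1 - q) :=
    mul_nonneg hp (negMulLog_nonneg (by linarith) (by linarith))
  have h9 := mul_le_mul_of_nonneg_left (negMulLog_one_sub_le hp1) (sub_nonneg.2 hq1)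
  have h10 := mul_le_mul_of_nonneg_left (negMulLog_one_sub_le hq1) (sub_nonneg.2 hp1)
  have h11 := log_two_lt_d9
  have h12 : ((1 - p) * q + p * (1 - q)) * log 2 ≤ (p + q) * (7 / 10) :=
    mul_le_mul (by nlinarith) (by linarith) (log_nonneg (by norm_num)) (by linarith)
  nlinarith

theorem cross_le {a b c d : ℝ} (ha : 0 ≤ a) (hb : 0 ≤ b) (hc : 0 ≤ c) (hd : 0 ≤ d) :
    entropyDeficit (a * c + b * d) (a * d + b * c) ≤
      (a + b) * (c + d) * log 2 - c * ((a + b) * log 2 - entropyDeficit a b)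
        - a * ((c + d) * log 2 - entropyDeficit c d) + 17 / 10 * (b * (c + d) + d * (a + b)) := by
  rcases (add_nonneg ha hb).eq_or_lt with h | h
  · have ha' : a = 0 := by linarith
    have hb' : b = 0 := by linarith
    subst ha' hb'
    simp
  rcases (add_nonneg hc hd).eq_or_lt with h' | h'
  · have ha' : c = 0 := by linarith
    have hb' : d = 0 := by linarith
    subst ha' hb'
    simp
  set N := a + b with hN
  set M := c + d with hM
  have hb1 : b / N ≤ 1 := (div_le_one h).2 (by linarith)
  have hd1 : d / M ≤ 1 := (div_le_one h').2 (by linarith)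
  have key := mul_le_mul_of_nonneg_left
    (cross_le_of_one (p := b / N) (q := d / M) (by positivity) (by positivity) hb1 hd1)
    (mul_pos h h').le
  have ea : a = N * (1 - b / N) := by field_simp; linarith
  have eb : b = N * (b / N) := by field_simp
  have ec : c = M * (1 - d / M) := by field_simp; linarith
  have ed : d = M * (d / M) := by field_simp
  rw [← mul] at key
  have e1 : N * entropyDeficit (1 - b / N) (b / N) = entropyDeficit a b := by
    rw [← mul, ← ea, ← eb]
  have e2 : M * entropyDeficit (1 - d / M) (d / M) = entropyDeficit c d := by
    rw [← mul, ← ec, ← ed]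
  rw [← e1, ← e2]
  generalize entropyDeficit (1 - b / N) (b / N) = X at *
  generalize entropyDeficit (1 - d / M) (d / M) = Y at *
  generalize b / N = p at *
  generalize d / M = q at *
  clear_value N M
  rw [ea, eb, ec, ed]
  refine le_of_eq_of_le (congrArg₂ _ ?_ ?_) (key.trans_eq ?_) <;> ring

end entropyDeficit

/-! ### Entropy gain from averaging in one direction. -/

section Step

open Real

variable {n : ℕ}

/-- Shannon entropy of a mass function on `𝔽₂ⁿ`. -/
noncomputable def massEntropy (v : (Fin n → ZMod 2) → ℝ) : ℝ := ∑ x, negMulLog (v x)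

/-- Self-convolution on `𝔽₂ⁿ`, the law of the sum of two independent copies. -/
noncomputable def selfConv (v : (Fin n → ZMod 2) → ℝ) (z : Fin n → ZMod 2) : ℝ :=
  ∑ x, v x * v (z + x)

/-- Averaging in the direction `e`, i.e. adding an independent uniform multiple of `e`. -/
noncomputable def dirAvg (e : Fin n → ZMod 2) (v : (Fin n → ZMod 2) → ℝ)
    (x : Fin n → ZMod 2) : ℝ := (v x + v (x + e)) / 2

theorem vec_add_self (x : Fin n → ZMod 2) : x + x = 0 := by
  ext i
  exact CharTwo.add_self_eq_zero (x i)

theorem vec_add_add_self (x e : Fin n → ZMod 2) : x + e + e = x := by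
  rw [add_assoc, vec_add_self, add_zero]

theorem sum_vec_add (e : Fin n → ZMod 2) (f : (Fin n → ZMod 2) → ℝ) :
    ∑ x, f (x + e) = ∑ x, f x :=
  Equiv.sum_comp (Equiv.addRight e) f

theorem sum_add_vec (e : Fin n → ZMod 2) (f : (Fin n → ZMod 2) → ℝ) :
    ∑ x, f (e + x) = ∑ x, f x :=
  Equiv.sum_comp (Equiv.addLeft e) f

theorem sum_dirAvg (e : Fin n → ZMod 2) (v : (Fin n → ZMod 2) → ℝ) :
    ∑ x, dirAvg e v x = ∑ x, v x := by
  unfold dirAvg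
  rw [← Finset.sum_div, Finset.sum_add_distrib, sum_vec_add]
  ring

theorem sum_selfConv (v : (Fin n → ZMod 2) → ℝ) : ∑ z, selfConv v z = (∑ x, v x) ^ 2 := by
  unfold selfConv
  rw [Finset.sum_comm]
  simp_rw [← Finset.mul_sum, sum_vec_add]
  rw [← Finset.sum_mul, sq]

/-- The sum of two independent uniform multiples of `e` is again a uniform multiple of `e`. -/
theorem selfConv_dirAvg (e : Fin n → ZMod 2) (v : (Fin n → ZMod 2) → ℝ) :
    selfConv (dirAvg e v) = dirAvg e (selfConv v) := by
  ext z
  unfold selfConv dirAvg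
  have h1 : ∑ x, v (x + e) * v (z + x) = ∑ x, v x * v (z + e + x) := by
    rw [← sum_vec_add e fun x => v x * v (z + e + x)]
    refine Finset.sum_congr rfl fun x _ => ?_
    rw [show z + e + (x + e) = z + x + e + e by abel, vec_add_add_self]
  have h2 : ∑ x, v (x + e) * v (z + x + e) = ∑ x, v x * v (z + x) := by
    rw [← sum_vec_add e fun x => v x * v (z + x)]
    simp_rw [add_assoc]
  have h3 : ∑ x, v x * v (z + x + e) = ∑ x, v x * v (z + e + x) := by
    simp_rw [add_right_comm]
  calc _ = (∑ x, v x * v (z + x) + ∑ x, v (x + e) * v (z + x)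
        + ∑ x, v x * v (z + x + e) + ∑ x, v (x + e) * v (z + x + e)) / 4 := by
        rw [← Finset.sum_add_distrib, ← Finset.sum_add_distrib, ← Finset.sum_add_distrib,
          Finset.sum_div]
        exact Finset.sum_congr rfl fun x _ => by ring
    _ = _ := by rw [h1, h2, h3]; ring

theorem massEntropy_dirAvg_sub (e : Fin n → ZMod 2) (v : (Fin n → ZMod 2) → ℝ) :
    massEntropy (dirAvg e v) - massEntropy v =
      (∑ x, entropyDeficit (v x) (v (x + e))) / 2 := by
  unfold massEntropy entropyDeficit dirAvg
  rw [Finset.sum_sub_distrib, Finset.sum_sub_distrib, ← Finset.mul_sum,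
    sum_vec_add e fun x => negMulLog (v x)]
  ring

/-- The deficit of the convolution is controlled by the deficits of products of fibres. -/
theorem sum_entropyDeficit_selfConv_le {v : (Fin n → ZMod 2) → ℝ} (hv : ∀ x, 0 ≤ v x)
    (e : Fin n → ZMod 2) :
    ∑ z, entropyDeficit (selfConv v z) (selfConv v (z + e)) ≤
      (∑ x, ∑ y, entropyDeficit (v x * v y + v (x + e) * v (y + e))
        (v x * v (y + e) + v (x + e) * v y)) / 2 := by
  -- Pairing x with x + e writes the values at z and z + e as sums over products of two-point
  -- fibres, to which subadditivity applies.
  have h1 : ∀ z, selfConv v z = ∑ x, (1 / 2 : ℝ) * (v x * v (z + x) + v (x + e) * v (z + x + e)) := by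
    intro z
    rw [← Finset.mul_sum, Finset.sum_add_distrib]
    have := sum_vec_add e fun x => v x * v (z + x)
    simp only [← add_assoc] at this
    rw [this]
    unfold selfConv
    ring
  have h2 : ∀ z, selfConv v (z + e) =
      ∑ x, (1 / 2 : ℝ) * (v x * v (z + x + e) + v (x + e) * v (z + x)) := by
    intro z
    rw [h1]
    refine Finset.sum_congr rfl fun x _ => ?_
    rw [show z + e + x = z + x + e by abel, vec_add_add_self]
  calc _ ≤ ∑ z, ∑ x, (1 / 2 : ℝ) * entropyDeficit (v x * v (z + x) + v (x + e) * v (z + x + e))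
        (v x * v (z + x + e) + v (x + e) * v (z + x)) := by
        refine Finset.sum_le_sum fun z _ => ?_
        rw [h1, h2]
        refine (entropyDeficit.sum_le _ ?_ ?_).trans_eq ?_
        · intro x
          have := mul_nonneg (hv x) (hv (z + x))
          have := mul_nonneg (hv (x + e)) (hv (z + x + e))
          linarith
        · intro x
          have := mul_nonneg (hv x) (hv (z + x + e))
          have := mul_nonneg (hv (x + e)) (hv (z + x))
          linarith
        · simp_rw [entropyDeficit.mul]
    _ = _ := by
        rw [Finset.sum_comm, Finset.sum_div]
        refine Finset.sum_congr rfl fun x _ => ?_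
        rw [sum_vec_add x fun y => (1 / 2 : ℝ) * entropyDeficit (v x * v y + v (x + e) * v (y + e))
          (v x * v (y + e) + v (x + e) * v y), ← Finset.mul_sum]
        ring

variable {v : (Fin n → ZMod 2) → ℝ} (hv : ∀ x, 0 ≤ v x) (h1 : ∑ x, v x = 1)
  (e : Fin n → ZMod 2)
include hv h1

/-- The fibre of y contributes the factor |v y - v (y + e)| of `cross_le_mul`; these factors sum to
2(1 - m), where m is the sum of the minima. -/
theorem massEntropy_selfConv_step_le_mul :
    massEntropy (dirAvg e (selfConv v)) - massEntropy (selfConv v) ≤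
      (massEntropy (dirAvg e v) - massEntropy v) * (1 - ∑ x, min (v x) (v (x + e))) := by
  rw [massEntropy_dirAvg_sub, massEntropy_dirAvg_sub]
  have h2 := sum_entropyDeficit_selfConv_le hv e
  have h3 : ∀ x y, entropyDeficit (v x * v y + v (x + e) * v (y + e))
      (v x * v (y + e) + v (x + e) * v y) ≤
      (v y + v (y + e) - 2 * min (v y) (v (y + e))) * entropyDeficit (v x) (v (x + e)) := by
    intro x y
    rcases le_total (v (y + e)) (v y) with h | h
    · rw [min_eq_right h]
      refine (entropyDeficit.cross_le_mul (hv _) (hv _) (hv _) h).trans_eq ?_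
      ring
    · rw [min_eq_left h, entropyDeficit.comm]
      refine (entropyDeficit.cross_le_mul (hv _) (hv _) (hv _) h).trans_eq ?_
      ring
  have h4 := Finset.sum_le_sum fun x (_ : x ∈ Finset.univ) =>
    Finset.sum_le_sum fun y (_ : y ∈ Finset.univ) => h3 x y
  simp_rw [← Finset.sum_mul, ← Finset.mul_sum, Finset.sum_sub_distrib, Finset.sum_add_distrib,
    ← Finset.mul_sum, sum_vec_add, h1] at h4
  nlinarith

/-- With η = log 2 - gain, the conditional entropy along `e`, this says that η becomes at least (2 -
m)η - 1.7m: it nearly doubles when m is small compared with η. -/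
theorem massEntropy_selfConv_step_le :
    massEntropy (dirAvg e (selfConv v)) - massEntropy (selfConv v) ≤
      log 2 - 2 * (1 - (∑ x, min (v x) (v (x + e))) / 2)
        * (log 2 - (massEntropy (dirAvg e v) - massEntropy v))
        + 17 / 10 * ∑ x, min (v x) (v (x + e)) := by
  rw [massEntropy_dirAvg_sub, massEntropy_dirAvg_sub]
  have h2 := sum_entropyDeficit_selfConv_le hv e
  set N : (Fin n → ZMod 2) → ℝ := fun x => v x + v (x + e) with hN
  set M : (Fin n → ZMod 2) → ℝ := fun x => min (v x) (v (x + e)) with hM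
  set D : (Fin n → ZMod 2) → ℝ := fun x => entropyDeficit (v x) (v (x + e)) with hD
  have key : ∀ x y, entropyDeficit (v x * v y + v (x + e) * v (y + e))
      (v x * v (y + e) + v (x + e) * v y) ≤
      N x * N y * log 2 - (N y - M y) * (N x * log 2 - D x) - (N x - M x) * (N y * log 2 - D y)
        + 17 / 10 * (M x * N y + M y * N x) := by
    intro x y
    simp only [hN, hM, hD]
    have A := hv x
    have B := hv (x + e)
    have C := hv y
    have E := hv (y + e)
    -- The four cases place the smaller mass of each fibre in the second slot of `cross_le`.
    rcases le_total (v (x + e)) (v x) with h | h <;>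
      rcases le_total (v (y + e)) (v y) with h' | h' <;>
      simp only [min_eq_left, min_eq_right, h, h']
    · refine (entropyDeficit.cross_le A B C E).trans_eq ?_
      ring
    · rw [entropyDeficit.comm (v y), entropyDeficit.comm (_ + _)]
      refine (entropyDeficit.cross_le A B E C).trans_eq ?_
      ring
    · rw [entropyDeficit.comm (v x) (v (x + e)), entropyDeficit.comm (_ + _), add_comm (_ * _),
        add_comm (v x * v y)]
      refine (entropyDeficit.cross_le B A C E).trans_eq ?_
      ring
    · rw [entropyDeficit.comm (v x) (v (x + e)), entropyDeficit.comm (v y) (v (y + e)),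
        add_comm (_ * _), add_comm (v x * v (y + e))]
      refine (entropyDeficit.cross_le B A E C).trans_eq ?_
      ring
  have hNs : ∑ x, N x = 2 := by
    simp only [hN, Finset.sum_add_distrib, sum_vec_add, h1]
    norm_num
  have h4 := Finset.sum_le_sum fun x (_ : x ∈ Finset.univ) =>
    Finset.sum_le_sum fun y (_ : y ∈ Finset.univ) => key x y
  simp only [Finset.sum_add_distrib, Finset.sum_sub_distrib, ← Finset.mul_sum, ← Finset.sum_mul,
    hNs] at h4
  linarith

/-- The entropy gain in direction `e` is a fixed proportion of the deficit when the coordinate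
is often nonzero, and of the conditional entropy when it is rarely nonzero. -/
theorem entropy_gain_of_large (hm : 1 / 8 ≤ ∑ x, min (v x) (v (x + e))) :
    (massEntropy (dirAvg e v) - massEntropy v) / 45 ≤
      (massEntropy (dirAvg e v) - massEntropy v) -
        (massEntropy (dirAvg e (selfConv v)) - massEntropy (selfConv v)) := by
  have h2 := massEntropy_selfConv_step_le_mul hv h1 e
  have h3 : 0 ≤ massEntropy (dirAvg e v) - massEntropy v := by
    rw [massEntropy_dirAvg_sub]
    exact div_nonneg (Finset.sum_nonneg fun x _ => entropyDeficit.nonneg (hv _) (hv _)) (by norm_num)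
  nlinarith

theorem entropy_gain_of_small (hm : ∑ x, min (v x) (v (x + e)) ≤ 1 / 8) :
    (log 2 - (massEntropy (dirAvg e v) - massEntropy v)) / 45 ≤
      (massEntropy (dirAvg e v) - massEntropy v) -
        (massEntropy (dirAvg e (selfConv v)) - massEntropy (selfConv v)) := by
  have h2 := massEntropy_selfConv_step_le_mul hv h1 e
  have h3 := massEntropy_selfConv_step_le hv h1 e
  have h4 : 0 ≤ ∑ x, min (v x) (v (x + e)) := Finset.sum_nonneg fun x _ => le_min (hv _) (hv _)
  have h5 := log_two_gt_d9
  generalize massEntropy (dirAvg e v) - massEntropy v = κ at *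
  generalize massEntropy (dirAvg e (selfConv v)) - massEntropy (selfConv v) = κ' at *
  generalize ∑ x, min (v x) (v (x + e)) = m at *
  obtain ⟨η, rfl⟩ : ∃ η, κ = log 2 - η := ⟨log 2 - κ, by ring⟩
  generalize log 2 = l at *
  -- The two bounds read κ - κ' ≥ m(l - η) and κ - κ' ≥ (1 - m)η - 1.7m. The first settles η ≤ 0.
  -- For 0 ≤ η ≤ 1/2 the factor l - η stays away from 0, so the first wins when m is large compared
  -- with η and the second otherwise. For η ≥ 1/2 the second suffices, as m ≤ 1/8. The constant 45
  -- is not sharp.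
  rcases le_total η 0 with h | h
  · nlinarith
  have h6 : m * η ≤ 1 / 8 * η := mul_le_mul_of_nonneg_right hm h
  rcases le_total η (1 / 2) with h' | h'
  · nlinarith
  · nlinarith

end Step

/-! ### Averaging over sets of coordinates, and decreasing mass functions. -/

section Average

open Real

variable {n : ℕ}

/-- The coordinate subspace as a finset. -/
def coordFinset (S : Finset (Fin n)) : Finset (Fin n → ZMod 2) :=
  Finset.univ.filter fun x => ∀ i, i ∉ S → x i = 0

theorem mem_coordFinset {S : Finset (Fin n)} {x : Fin n → ZMod 2} :
    x ∈ coordFinset S ↔ ∀ i, i ∉ S → x i = 0 := by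
  simp [coordFinset]

theorem zmod_two_eq_one {a : ZMod 2} (h : a ≠ 0) : a = 1 := by
  revert a
  decide

theorem coordFinset_insert {i : Fin n} {S : Finset (Fin n)} (hi : i ∉ S) :
    coordFinset (insert i S) =
      (coordFinset S).disjUnion ((coordFinset S).map (addRightEmbedding (Pi.single i 1))) (by
        rw [Finset.disjoint_left]
        intro x hx hx'
        obtain ⟨y, hy, rfl⟩ := Finset.mem_map.1 hx'
        have h1 := mem_coordFinset.1 hx i hi
        have h2 := mem_coordFinset.1 hy i hi
        simp [h2] at h1) := by
  ext x
  rw [Finset.mem_disjUnion, Finset.mem_map]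
  constructor
  · intro hx
    rw [mem_coordFinset] at hx
    by_cases h : x i = 0
    · refine Or.inl (mem_coordFinset.2 fun j hj => ?_)
      by_cases hji : j = i
      · rw [hji, h]
      · exact hx j (by simp [hj, hji])
    · refine Or.inr ⟨x + Pi.single i 1, mem_coordFinset.2 fun j hj => ?_, vec_add_add_self _ _⟩
      by_cases hji : j = i
      · subst hji
        simp [zmod_two_eq_one h, CharTwo.add_self_eq_zero]
      · simp [hji, hx j (by simp [hj, hji])]
  · rintro (hx | ⟨y, hy, rfl⟩)
    · exact mem_coordFinset.2 fun j hj => mem_coordFinset.1 hx j fun h => hj (by simp [h])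
    · refine mem_coordFinset.2 fun j hj => ?_
      have hji : j ≠ i := fun h => hj (by simp [h])
      have := mem_coordFinset.1 hy j fun h => hj (by simp [h])
      simp [hji, this]

theorem coordFinset_empty : coordFinset (∅ : Finset (Fin n)) = {0} := by
  ext x
  simp [mem_coordFinset, funext_iff]

theorem card_coordFinset (S : Finset (Fin n)) : (coordFinset S).card = 2 ^ S.card := by
  induction S using Finset.induction_on with
  | empty => simp [coordFinset_empty]
  | insert i S hi ih =>
    rw [coordFinset_insert hi, Finset.card_disjUnion, Finset.card_map, ih,
      Finset.card_insert_of_notMem hi, pow_succ, mul_two]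

/-- Averaging over all translates by a coordinate subspace. -/
noncomputable def coordAvg (S : Finset (Fin n)) (v : (Fin n → ZMod 2) → ℝ)
    (x : Fin n → ZMod 2) : ℝ := (∑ y ∈ coordFinset S, v (x + y)) / 2 ^ S.card

theorem coordAvg_empty (v : (Fin n → ZMod 2) → ℝ) : coordAvg ∅ v = v := by
  ext x
  simp [coordAvg, coordFinset_empty]

theorem coordAvg_insert {i : Fin n} {S : Finset (Fin n)} (hi : i ∉ S)
    (v : (Fin n → ZMod 2) → ℝ) :
    coordAvg (insert i S) v = dirAvg (Pi.single i 1) (coordAvg S v) := by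
  ext x
  unfold coordAvg dirAvg
  rw [coordFinset_insert hi, Finset.sum_disjUnion, Finset.sum_map,
    Finset.card_insert_of_notMem hi, ← add_div, div_div, ← pow_succ]
  congr 2
  refine Finset.sum_congr rfl fun y _ => ?_
  rw [addRightEmbedding_apply, add_right_comm, add_assoc]

theorem coordAvg_univ {v : (Fin n → ZMod 2) → ℝ} (h1 : ∑ x, v x = 1) (x : Fin n → ZMod 2) :
    coordAvg Finset.univ v x = 1 / 2 ^ n := by
  have : coordFinset (Finset.univ : Finset (Fin n)) = Finset.univ := by
    ext
    simp [mem_coordFinset]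
  rw [coordAvg, this, sum_add_vec, h1, Finset.card_univ, Fintype.card_fin]

/-- Mass functions that decrease when a coordinate is switched on. -/
def IsDecreasing (v : (Fin n → ZMod 2) → ℝ) : Prop :=
  ∀ i x, x i = 0 → v (x + Pi.single i 1) ≤ v x

theorem IsDecreasing.dirAvg {v : (Fin n → ZMod 2) → ℝ} (hv : IsDecreasing v) (j : Fin n) :
    IsDecreasing (dirAvg (Pi.single j 1) v) := by
  intro i x hx
  unfold _root_.dirAvg
  by_cases hij : i = j
  · subst hij
    rw [vec_add_add_self, add_comm]
  · have h1 := hv i x hx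
    have h2 := hv i (x + Pi.single j 1) (by simp [hij, hx])
    rw [add_right_comm] at h2
    linarith

theorem IsDecreasing.coordAvg {v : (Fin n → ZMod 2) → ℝ} (hv : IsDecreasing v)
    (S : Finset (Fin n)) : IsDecreasing (coordAvg S v) := by
  induction S using Finset.induction_on with
  | empty => rwa [coordAvg_empty]
  | insert i S hi ih =>
    rw [coordAvg_insert hi]
    exact ih.dirAvg i

theorem coordAvg_nonneg {v : (Fin n → ZMod 2) → ℝ} (hv : ∀ x, 0 ≤ v x) (S : Finset (Fin n))
    (x : Fin n → ZMod 2) : 0 ≤ coordAvg S v x :=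
  div_nonneg (Finset.sum_nonneg fun _ _ => hv _) (by positivity)

theorem sum_coordAvg (v : (Fin n → ZMod 2) → ℝ) (S : Finset (Fin n)) :
    ∑ x, coordAvg S v x = ∑ x, v x := by
  induction S using Finset.induction_on with
  | empty => rw [coordAvg_empty]
  | insert i S hi ih => rw [coordAvg_insert hi, sum_dirAvg, ih]

/-- Twice the mass of the points whose `i`-th coordinate is nonzero, if `v` is decreasing. -/
noncomputable def coordMass (i : Fin n) (v : (Fin n → ZMod 2) → ℝ) : ℝ :=
  ∑ x, min (v x) (v (x + Pi.single i 1))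

/-- For decreasing `v` the minimum always sits at the point with i-th coordinate 1, before and after
averaging, so it is linear in `v`. For general `v` averaging could increase the sum of minima. -/
theorem coordMass_dirAvg {v : (Fin n → ZMod 2) → ℝ} (hv : IsDecreasing v) {i j : Fin n}
    (hij : i ≠ j) : coordMass i (dirAvg (Pi.single j 1) v) = coordMass i v := by
  unfold coordMass
  refine Eq.trans (Finset.sum_congr rfl fun x _ => ?_)
    (sum_dirAvg (Pi.single j 1) fun x => min (v x) (v (x + Pi.single i 1)))
  have hd := hv.dirAvg j
  have hle : ∀ y : Fin n → ZMod 2, y i ≠ 0 → (y + Pi.single i 1 : Fin n → ZMod 2) i = 0 := fun y hy => by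
    simp [zmod_two_eq_one hy, CharTwo.add_self_eq_zero]
  by_cases h : x i = 0
  · rw [min_eq_right (hd i x h)]
    have h1 := hv i x h
    have h2 := hv i (x + Pi.single j 1) (by simp [hij, h])
    unfold dirAvg
    beta_reduce
    rw [min_eq_right h1, min_eq_right h2, add_right_comm]
  · have h0 := hd i _ (hle x h)
    have h1 := hv i _ (hle x h)
    have h2 := hv i _ (hle (x + Pi.single j 1) (by simp [hij, h]))
    rw [vec_add_add_self] at h0 h1 h2
    rw [min_eq_left h0]
    unfold dirAvg
    beta_reduce
    rw [min_eq_left h1, min_eq_left h2]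

theorem coordMass_coordAvg {v : (Fin n → ZMod 2) → ℝ} (hv : IsDecreasing v) {i : Fin n}
    {S : Finset (Fin n)} (hi : i ∉ S) : coordMass i (coordAvg S v) = coordMass i v := by
  induction S using Finset.induction_on with
  | empty => rw [coordAvg_empty]
  | insert j S hj ih =>
    rw [Finset.mem_insert, not_or] at hi
    rw [coordAvg_insert hj, coordMass_dirAvg (hv.coordAvg S) hi.1, ih hi.2]

/-- Setting the coordinates in `S` to zero. -/
def zeroOn (S : Finset (Fin n)) (x : Fin n → ZMod 2) : Fin n → ZMod 2 :=
  fun i => if i ∈ S then 0 else x i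

theorem IsDecreasing.le_zeroOn {v : (Fin n → ZMod 2) → ℝ} (hv : IsDecreasing v)
    (S : Finset (Fin n)) (x : Fin n → ZMod 2) : v x ≤ v (zeroOn S x) := by
  induction S using Finset.induction_on with
  | empty => exact le_of_eq (congrArg v (by ext; simp [zeroOn]))
  | insert i S hi ih =>
    refine ih.trans ?_
    by_cases h : x i = 0
    · refine le_of_eq (congrArg v ?_)
      ext j
      by_cases hj : j = i
      · subst hj
        simp [zeroOn, h]
      · simp [zeroOn, hj]
    · have h1 : zeroOn S x = zeroOn (insert i S) x + Pi.single i 1 := by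
        ext j
        by_cases hj : j = i
        · subst hj
          simp [zeroOn, hi, zmod_two_eq_one h]
        · simp [zeroOn, hj]
      rw [h1]
      exact hv i _ (by simp [zeroOn])

theorem IsDecreasing.le_zero {v : (Fin n → ZMod 2) → ℝ} (hv : IsDecreasing v)
    (x : Fin n → ZMod 2) : v x ≤ v 0 := by
  convert hv.le_zeroOn Finset.univ x using 2
  ext
  simp [zeroOn]

theorem massEntropy_le_log_card {v : (Fin n → ZMod 2) → ℝ} (hv : ∀ x, 0 ≤ v x)
    (h1 : ∑ x, v x = 1) {B : Finset (Fin n → ZMod 2)} (hB : B.Nonempty)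
    (hvB : ∀ x, x ∉ B → v x = 0) : massEntropy v ≤ log B.card := by
  have hN : (0 : ℝ) < B.card := by exact_mod_cast hB.card_pos
  have hs : ∑ x ∈ B, v x = 1 := by
    rw [← h1]
    exact Finset.sum_subset (Finset.subset_univ _) fun x _ hx => hvB x hx
  have e : massEntropy v = ∑ x ∈ B, negMulLog (v x) :=
    (Finset.sum_subset (Finset.subset_univ _) fun x _ hx => by simp [hvB x hx]).symm
  rw [e]
  calc _ ≤ ∑ x ∈ B, (v x * log B.card - v x + (B.card : ℝ)⁻¹) := by
        refine Finset.sum_le_sum fun x _ => ?_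
        have hr : 0 < (B.card : ℝ)⁻¹ := by positivity
        have := entropyDeficit.mul_log_le (hv x) one_pos hr.le fun h => absurd h hr.ne'
        rw [log_inv, log_one] at this
        unfold negMulLog
        linarith
    _ = _ := by
        rw [Finset.sum_add_distrib, Finset.sum_sub_distrib, ← Finset.sum_mul, hs]
        simp [hN.ne']

theorem massEntropy_le_coordAvg {v : (Fin n → ZMod 2) → ℝ} (hv : ∀ x, 0 ≤ v x)
    (S : Finset (Fin n)) : massEntropy v ≤ massEntropy (coordAvg S v) := by
  induction S using Finset.induction_on with
  | empty => rw [coordAvg_empty]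
  | insert i S hi ih =>
    rw [coordAvg_insert hi]
    have h : 0 ≤ massEntropy (dirAvg (Pi.single i 1) (coordAvg S v))
        - massEntropy (coordAvg S v) := by
      rw [massEntropy_dirAvg_sub]
      exact div_nonneg (Finset.sum_nonneg fun x _ =>
        entropyDeficit.nonneg (coordAvg_nonneg hv S _) (coordAvg_nonneg hv S _)) (by norm_num)
    linarith

/-- Min-entropy is at most Shannon entropy, and a decreasing function is largest at 0. -/
theorem neg_log_zero_le_massEntropy {v : (Fin n → ZMod 2) → ℝ} (hv : ∀ x, 0 ≤ v x)
    (h1 : ∑ x, v x = 1) (hd : IsDecreasing v) : -log (v 0) ≤ massEntropy v := by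
  calc -log (v 0) = ∑ x, v x * -log (v 0) := by rw [← Finset.sum_mul, h1, one_mul]
    _ ≤ _ := by
      refine Finset.sum_le_sum fun x _ => ?_
      rcases (hv x).eq_or_lt with h | h
      · simp [← h]
      · have := mul_le_mul_of_nonneg_left (log_le_log h (hd.le_zero x)) h.le
        unfold negMulLog
        linarith

theorem entropy_gain_coordAvg_of_large {v : (Fin n → ZMod 2) → ℝ} (hv : ∀ x, 0 ≤ v x)
    (h1 : ∑ x, v x = 1) (hd : IsDecreasing v) (S : Finset (Fin n))
    (hS : ∀ i ∈ S, 1 / 8 ≤ coordMass i v) :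
    (massEntropy (coordAvg S v) - massEntropy v) / 45 ≤
      (massEntropy (coordAvg S v) - massEntropy v) -
        (massEntropy (selfConv (coordAvg S v)) - massEntropy (selfConv v)) := by
  induction S using Finset.induction_on with
  | empty => simp [coordAvg_empty]
  | insert i S hi ih =>
    have h2 := ih fun j hj => hS j (Finset.mem_insert_of_mem hj)
    have h3 := entropy_gain_of_large (coordAvg_nonneg hv S) ((sum_coordAvg v S).trans h1)
      (Pi.single i 1) ((hS i (Finset.mem_insert_self _ _)).trans_eq (coordMass_coordAvg hd hi).symm)
    rw [coordAvg_insert hi, selfConv_dirAvg]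
    linarith

theorem entropy_gain_coordAvg_of_small {v : (Fin n → ZMod 2) → ℝ} (hv : ∀ x, 0 ≤ v x)
    (h1 : ∑ x, v x = 1) (hd : IsDecreasing v) {S T : Finset (Fin n)} (hST : Disjoint S T)
    (hS : ∀ i ∈ S, coordMass i v ≤ 1 / 8) :
    (S.card * log 2 - (massEntropy (coordAvg (S ∪ T) v) - massEntropy (coordAvg T v))) / 45 ≤
      (massEntropy (coordAvg (S ∪ T) v) - massEntropy (coordAvg T v)) -
        (massEntropy (selfConv (coordAvg (S ∪ T) v)) -
          massEntropy (selfConv (coordAvg T v))) := by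
  induction S using Finset.induction_on with
  | empty => simp
  | insert i S hi ih =>
    rw [Finset.disjoint_insert_left] at hST
    have hi' : i ∉ S ∪ T := by simp [hi, hST.1]
    have h2 := ih hST.2 fun j hj => hS j (Finset.mem_insert_of_mem hj)
    have h3 := entropy_gain_of_small (coordAvg_nonneg hv (S ∪ T)) ((sum_coordAvg v _).trans h1)
      (Pi.single i 1) ((coordMass_coordAvg hd hi').trans_le (hS i (Finset.mem_insert_self _ _)))
    rw [Finset.insert_union, coordAvg_insert hi', selfConv_dirAvg, Finset.card_insert_of_notMem hi]
    push_cast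
    linarith

/-- For a decreasing mass function, the entropy growth under self-convolution controls the
distance to a uniform distribution on a coordinate subspace. -/
theorem exists_coords_entropy_growth {v : (Fin n → ZMod 2) → ℝ} (hv : ∀ x, 0 ≤ v x)
    (h1 : ∑ x, v x = 1) (hd : IsDecreasing v) :
    ∃ J : Finset (Fin n),
      ((massEntropy (coordAvg J v) - massEntropy v) +
        (massEntropy (coordAvg J v) - J.card * log 2)) / 45 ≤
        massEntropy (selfConv v) - massEntropy v := by
  classical
  refine ⟨Finset.univ.filter fun i => 1 / 8 ≤ coordMass i v, ?_⟩
  set J := Finset.univ.filter fun i => 1 / 8 ≤ coordMass i v with hJ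
  have h2 := entropy_gain_coordAvg_of_large hv h1 hd J (by simp [hJ])
  have h3 := entropy_gain_coordAvg_of_small hv h1 hd (S := Jᶜ) (T := J) disjoint_compl_left
    (fun i hi => by
      simp only [hJ, Finset.mem_compl, Finset.mem_filter, Finset.mem_univ, true_and, not_le] at hi
      exact hi.le)
  -- After all coordinates the law is uniform and equal to its self-convolution, so the gains
  -- telescope to the whole entropy growth of `v`.
  have hU : coordAvg (Jᶜ ∪ J) v = fun _ => 1 / 2 ^ n := by
    rw [Finset.union_comm, Finset.union_compl]
    exact funext (coordAvg_univ h1)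
  have hU' : selfConv (fun _ : Fin n → ZMod 2 => (1 / 2 ^ n : ℝ)) = fun _ => 1 / 2 ^ n := by
    ext z
    simp [selfConv]
  have hE : massEntropy (fun _ : Fin n → ZMod 2 => (1 / 2 ^ n : ℝ)) = n * log 2 := by
    simp [massEntropy, negMulLog]
  have hc : ((Jᶜ.card : ℕ) : ℝ) = n - J.card := by
    rw [Finset.card_compl, Nat.cast_sub (Finset.card_le_univ J), Fintype.card_fin]
  rw [hU, hU', hE, hc] at h3
  linarith

end Average

/-! ### Uniform laws on downsets, and covering by coordinate subspaces. -/

section Downset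

open Real

variable {n : ℕ}

/-- The uniform distribution on a finite set. -/
noncomputable def uniformMass (A : Finset (Fin n → ZMod 2)) (x : Fin n → ZMod 2) : ℝ :=
  if x ∈ A then (A.card : ℝ)⁻¹ else 0

theorem uniformMass_nonneg (A : Finset (Fin n → ZMod 2)) (x : Fin n → ZMod 2) :
    0 ≤ uniformMass A x := by
  unfold uniformMass
  split_ifs <;> positivity

theorem sum_uniformMass {A : Finset (Fin n → ZMod 2)} (hA : A.Nonempty) :
    ∑ x, uniformMass A x = 1 := by
  have : (A.card : ℝ) ≠ 0 := by exact_mod_cast hA.card_pos.ne'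
  simp [uniformMass, Finset.sum_ite_mem, this]

theorem massEntropy_uniformMass {A : Finset (Fin n → ZMod 2)} (hA : A.Nonempty) :
    massEntropy (uniformMass A) = log A.card := by
  have : (A.card : ℝ) ≠ 0 := by exact_mod_cast hA.card_pos.ne'
  have h : ∀ x, negMulLog (uniformMass A x) = if x ∈ A then negMulLog (A.card : ℝ)⁻¹ else 0 := by
    intro x
    unfold uniformMass
    split_ifs <;> simp
  simp only [massEntropy, h, Finset.sum_ite_mem, Finset.univ_inter, Finset.sum_const,
    nsmul_eq_mul]
  rw [negMulLog, log_inv]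
  field_simp

theorem IsDownset.isDecreasing_uniformMass {A : Finset (Fin n → ZMod 2)} (hA : IsDownset A) :
    IsDecreasing (uniformMass A) := by
  intro i x hx
  unfold uniformMass
  by_cases h : x + Pi.single i 1 ∈ A
  · rw [if_pos h, if_pos (hA i x hx h)]
  · rw [if_neg h]
    split_ifs <;> positivity

theorem IsDownset.zeroOn_mem {A : Finset (Fin n → ZMod 2)} (hA : IsDownset A)
    (S : Finset (Fin n)) {x : Fin n → ZMod 2} (hx : x ∈ A) : zeroOn S x ∈ A := by
  by_contra h
  have h1 := hA.isDecreasing_uniformMass.le_zeroOn S x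
  have h2 : (0 : ℝ) < (A.card : ℝ)⁻¹ :=
    inv_pos.2 (by exact_mod_cast Finset.card_pos.2 ⟨x, hx⟩)
  rw [uniformMass, if_pos hx, uniformMass, if_neg h] at h1
  linarith

theorem massEntropy_selfConv_uniformMass_le {A : Finset (Fin n → ZMod 2)} (hA : A.Nonempty) :
    massEntropy (selfConv (uniformMass A)) ≤ log (A + A).card := by
  refine massEntropy_le_log_card (fun z => Finset.sum_nonneg fun x _ =>
    mul_nonneg (uniformMass_nonneg A _) (uniformMass_nonneg A _)) ?_ (hA.add hA) fun z hz => ?_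
  · change ∑ z, selfConv (uniformMass A) z = 1
    rw [sum_selfConv, sum_uniformMass hA, one_pow]
  · refine Finset.sum_eq_zero fun x _ => ?_
    by_cases hx : x ∈ A
    · have : z + x ∉ A := fun h => hz <| by
        have := Finset.add_mem_add h hx
        rwa [vec_add_add_self] at this
      simp [uniformMass, this]
    · simp [uniformMass, hx]

theorem coordAvg_uniformMass_zero (A : Finset (Fin n → ZMod 2)) (J : Finset (Fin n)) :
    coordAvg J (uniformMass A) 0 =
      ((A.filter (· ∈ coordFinset J)).card : ℝ) / (A.card * 2 ^ J.card) := by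
  have h : (coordFinset J ∩ A) = A.filter (· ∈ coordFinset J) := by
    ext
    simp [and_comm]
  simp only [coordAvg, zero_add, uniformMass, Finset.sum_ite_mem, Finset.sum_const, nsmul_eq_mul, h]
  rw [← div_eq_mul_inv, div_div]

/-- The elements of `A` supported on `J`, and off `J`, have sums that are all distinct. -/
theorem card_filter_mul_card_filter_le (A : Finset (Fin n → ZMod 2)) (J : Finset (Fin n)) :
    (A.filter (· ∈ coordFinset Jᶜ)).card * (A.filter (· ∈ coordFinset J)).card ≤
      (A + A).card := by
  rw [← Finset.card_product]
  refine Finset.card_le_card_of_injOn (fun p => p.1 + p.2) ?_ ?_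
  · rintro ⟨x, y⟩ h
    simp only [Finset.coe_product, Set.mem_prod, Finset.mem_coe, Finset.mem_filter] at h
    exact Finset.add_mem_add h.1.1 h.2.1
  · rintro ⟨x, y⟩ h ⟨x', y'⟩ h' heq
    simp only [Finset.coe_product, Set.mem_prod, Finset.mem_coe, Finset.mem_filter,
      mem_coordFinset, Finset.mem_compl, not_not] at h h'
    have key : ∀ i, x i = x' i ∧ y i = y' i := by
      intro i
      have hi : x i + y i = x' i + y' i := congrFun heq i
      by_cases hJ : i ∈ J
      · rw [h.1.2 i hJ, h'.1.2 i hJ] at *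
        simpa using hi
      · rw [h.2.2 i hJ, h'.2.2 i hJ] at *
        simpa using hi
    exact Prod.ext (funext fun i => (key i).1) (funext fun i => (key i).2)

theorem natCard_coordSubspace (J : Finset (Fin n)) :
    Nat.card (coordSubspace J) = 2 ^ J.card := by
  rw [← card_coordFinset, ← Nat.card_eq_finsetCard]
  exact Nat.card_congr (Equiv.subtypeEquivRight fun x => mem_coordFinset.symm)

/-- A downset is covered by translates of a smaller coordinate subspace. -/
theorem IsDownset.subset_iUnion_vadd {A : Finset (Fin n → ZMod 2)} (hA : IsDownset A)
    {I J : Finset (Fin n)} (hIJ : I ⊆ J) :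
    (A : Set (Fin n → ZMod 2)) ⊆ ⋃ t ∈ A.filter (· ∈ coordFinset Jᶜ) + coordFinset (J \ I),
      t +ᵥ (coordSubspace I : Set (Fin n → ZMod 2)) := by
  intro a ha
  simp only [Set.mem_iUnion]
  -- Split `a` into its parts off J, on J \ I and on I; the first stays in `A` because `A` is a
  -- downset.
  refine ⟨zeroOn J a + (zeroOn I a - zeroOn J a), Finset.add_mem_add ?_ ?_, ?_⟩
  · refine Finset.mem_filter.2 ⟨hA.zeroOn_mem J ha, mem_coordFinset.2 fun i hi => ?_⟩
    rw [Finset.mem_compl, not_not] at hi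
    simp [zeroOn, hi]
  · refine mem_coordFinset.2 fun i hi => ?_
    rw [Finset.mem_sdiff, not_and_not_right] at hi
    by_cases hJ : i ∈ J
    · simp [zeroOn, hJ, hi hJ]
    · have hI : i ∉ I := fun h => hJ (hIJ h)
      simp [zeroOn, hJ, hI]
  · refine Set.mem_vadd_set.2 ⟨a - zeroOn I a, fun i hi => ?_, ?_⟩
    · simp [zeroOn, hi]
    · simp

/-- Passing to a subset of `J` whose coordinate subspace has at most `N` elements. -/
theorem exists_subset_two_pow_card_le {N : ℕ} (hN : 0 < N) (J : Finset (Fin n)) :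
    ∃ I ⊆ J, 2 ^ I.card ≤ N ∧
      (2 : ℝ) ^ (J \ I).card ≤ max (1 : ℝ) (2 * ((2 : ℝ) ^ J.card / N)) := by
  by_cases h : 2 ^ J.card ≤ N
  · exact ⟨J, subset_rfl, h, by simp⟩
  have h1 : Nat.log 2 N ≤ J.card := by
    by_contra h'
    rw [not_le] at h h'
    have := (Nat.pow_le_pow_right two_pos h'.le).trans (Nat.pow_log_le_self 2 hN.ne')
    omega
  -- Rounding log₂ N down loses less than a factor 2, the origin of the 2 in the bound.
  obtain ⟨I, hIJ, hI⟩ := Finset.exists_subset_card_eq h1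
  refine ⟨I, hIJ, by rw [hI]; exact Nat.pow_log_le_self 2 hN.ne', le_max_of_le_right ?_⟩
  have h2 : (N : ℝ) ≤ 2 ^ I.card * 2 := by
    rw [hI, ← pow_succ]
    exact_mod_cast (Nat.lt_pow_succ_log_self one_lt_two N).le
  have h3 : (2 : ℝ) ^ J.card = 2 ^ (J \ I).card * 2 ^ I.card := by
    rw [← pow_add, Finset.card_sdiff_add_card_eq_card hIJ]
  have hN' : (0 : ℝ) < N := by exact_mod_cast hN
  rw [h3, ← mul_div_assoc, le_div_iff₀ hN']
  nlinarith [mul_le_mul_of_nonneg_left h2 (by positivity : (0 : ℝ) ≤ 2 ^ (J \ I).card)]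

end Downset

/-! ### From entropy growth to the cover. -/

theorem theorem1p10 :
    ∃ C : ℝ, 0 < C ∧
      ∀ (n : ℕ) (A : Finset (Fin n → ZMod 2)), A.Nonempty → IsDownset A →
        ∃ (J : Finset (Fin n)) (T : Finset (Fin n → ZMod 2)),
          Nat.card (coordSubspace J) ≤ A.card ∧
          (T.card : ℝ) ≤ C * ((σ[A] : ℚ≥0) : ℝ) ^ 46 ∧
          (A : Set (Fin n → ZMod 2)) ⊆
            ⋃ t ∈ T, t +ᵥ (coordSubspace J : Set (Fin n → ZMod 2)) := by
  refine ⟨2, two_pos, fun n A hA hd => ?_⟩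
  have hv := uniformMass_nonneg A
  have h1 := sum_uniformMass hA
  have hdec := hd.isDecreasing_uniformMass
  obtain ⟨J, hJ⟩ := exists_coords_entropy_growth hv h1 hdec
  obtain ⟨I, hIJ, hI, hcard⟩ := exists_subset_two_pow_card_le hA.card_pos J
  refine ⟨I, A.filter (· ∈ coordFinset Jᶜ) + coordFinset (J \ I),
    by rwa [natCard_coordSubspace], ?_, hd.subset_iUnion_vadd hIJ⟩
  set P := A.filter (· ∈ coordFinset Jᶜ)
  set Q := A.filter (· ∈ coordFinset J)
  have ha : (0 : ℝ) < A.card := by exact_mod_cast hA.card_pos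
  set a : ℝ := (A.card : ℝ)
  set K : ℝ := ((σ[A] : ℚ≥0) : ℝ)
  have hKA : K * a = (A + A).card := by
    have h := Finset.addConst_mul_card A A
    have h' := congrArg (fun q : ℚ≥0 => (q : ℝ)) h
    push_cast at h'
    exact h'
  have hAA : (0 : ℝ) < (A + A).card := by exact_mod_cast (hA.add hA).card_pos
  have hKpos : 0 < K := pos_of_mul_pos_left (hKA ▸ hAA) ha.le
  set E := massEntropy (coordAvg J (uniformMass A))
  have ht : Real.log a ≤ E := by
    have := massEntropy_le_coordAvg hv J
    rwa [massEntropy_uniformMass hA] at this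
  have hgrow : (E - Real.log a) + (E - J.card * Real.log 2) ≤ 45 * Real.log K := by
    have h2 := massEntropy_selfConv_uniformMass_le hA
    rw [massEntropy_uniformMass hA] at hJ
    rw [← hKA, Real.log_mul hKpos.ne' ha.ne'] at h2
    linarith
  have hQpos : (0 : ℝ) < Q.card := by
    obtain ⟨x, hx⟩ := hA
    have h0 := hd.zeroOn_mem Finset.univ hx
    have : (0 : ℝ) < Q.card ↔ 0 < Q.card := Nat.cast_pos
    rw [this, Finset.card_pos]
    exact ⟨_, Finset.mem_filter.2 ⟨h0, mem_coordFinset.2 fun i _ => by simp [zeroOn]⟩⟩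
  -- The averaged mass at 0 is |Q| / (|A| 2^|J|), so log |A| + j - log |Q| ≤ E. This yields both j ≤
  -- E, as |Q| ≤ |A|, and |A| ≤ |Q| exp(E - j).
  have hmax := neg_log_zero_le_massEntropy (coordAvg_nonneg hv J) ((sum_coordAvg _ J).trans h1)
    (hdec.coordAvg J)
  rw [coordAvg_uniformMass_zero, Real.log_div hQpos.ne' (by positivity),
    Real.log_mul ha.ne' (by positivity), Real.log_pow] at hmax
  set j : ℝ := (J.card : ℝ) * Real.log 2 with hj
  have hQle : (Q.card : ℝ) ≤ a := Nat.cast_le.2 (Finset.card_filter_le _ _)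
  have hlogQ := Real.log_le_log hQpos hQle
  have hj2 : Real.exp j = 2 ^ J.card := by
    rw [hj, Real.exp_nat_mul, Real.exp_log two_pos]
  have hPQ : (P.card : ℝ) * Q.card ≤ K * a := by
    rw [hKA]
    exact_mod_cast card_filter_mul_card_filter_le A J
  have hPc : (P.card : ℝ) ≤ K * Real.exp (E - j) := by
    have h2 : a ≤ Q.card * Real.exp (E - j) := by
      rw [← Real.log_le_log_iff ha (by positivity),
        Real.log_mul hQpos.ne' (Real.exp_ne_zero _), Real.log_exp]
      linarith
    have h3 : (P.card : ℝ) * Q.card ≤ K * Real.exp (E - j) * Q.card := by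
      nlinarith [mul_le_mul_of_nonneg_left h2 hKpos.le]
    exact le_of_mul_le_mul_right h3 hQpos
  have hK45 : Real.exp (45 * Real.log K) = K ^ 45 := by
    rw [show (45 : ℝ) = ((45 : ℕ) : ℝ) by norm_num, Real.exp_nat_mul, Real.exp_log hKpos]
  -- Each bracket in `hgrow` is nonnegative, so each is at most 45 log K. If the maximum is 1 the
  -- second bracket is used; otherwise exp(E - j) · 2 exp(j) / a = 2 exp(E - log a) and the first is
  -- used. The 46th factor K comes from `hPc`.
  have hbound : Real.exp (E - j) * (2 ^ (J \ I).card : ℝ) ≤ 2 * K ^ 45 := by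
    refine (mul_le_mul_of_nonneg_left hcard (Real.exp_pos _).le).trans ?_
    rw [← hK45, mul_max_of_nonneg _ _ (Real.exp_pos _).le, max_le_iff]
    have hj' : j ≤ E := by linarith
    constructor
    · have h2 := Real.exp_le_exp.2 (show E - j ≤ 45 * Real.log K by linarith)
      have h3 := Real.exp_pos (45 * Real.log K)
      linarith
    · have h2 := Real.exp_le_exp.2 (show E - Real.log a ≤ 45 * Real.log K by linarith)
      refine le_of_eq_of_le ?_ (mul_le_mul_of_nonneg_left h2 zero_le_two)
      rw [← hj2, Real.exp_sub, Real.exp_sub, Real.exp_log ha]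
      field_simp
  calc (((P + coordFinset (J \ I)).card : ℕ) : ℝ)
      ≤ P.card * 2 ^ (J \ I).card := by
        have := Finset.card_add_le (s := P) (t := coordFinset (J \ I))
        rw [card_coordFinset] at this
        exact_mod_cast this
    _ ≤ K * Real.exp (E - j) * 2 ^ (J \ I).card := by gcongr
    _ ≤ K * (2 * K ^ 45) := by
        rw [mul_assoc]
        gcongr
    _ = 2 * K ^ 46 := by ring
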